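/- Let $n \ge 1$, $s \in (0,1)$, and let $K \subset \mathbb{R}^n$ be a convex body (a compact convex set with non-empty interior) that is strictly convex, i.e. $(1-\lambda)x+\lambda y \in \operatorname{int} K$ for all $x,y\in K$ with $x \ne y$ and all $0<\lambda<1$, and unconditional, i.e. symmetric with respect to every coordinate hyperplane. Let $\|\cdot\|_K$ be the norm on $\mathbb{R}^n$ with closed unit ball $K$. For a Borel set $E \subseteq \mathbb{R}^n$ with complement $E^c$ and Lebesgue measure $|E|$, put $$P_s(E,K) = \int_E \int_{E^c} \frac{1}{\|x-y\|_K^{n+s}} \, dy \, dx \in [0,\infty],$$ and let $\gamma_{n,s}(K)$ be the optimal (largest) constant in the anisotropic fractional isoperimetric inequality $$P_s(E,K) \ge \gamma_{n,s}(K)\, |E|^{\frac{n-s}{n}} \qquad \text{for all bounded Borel sets } E \subset \mathbb{R}^n.$$ Let $M$ be a minimizer of this inequality, i.e. a bounded Borel set with $|M|>0$ and $P_s(M,K) = \gamma_{n,s}(K)\,|M|^{(n-s)/n}$. Then $M$ is, up to translation and a null set, an unconditional star body: there are $v \in \mathbb{R}^n$ and an unconditional star body $L \subset \mathbb{R}^n$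 such that $M$ and $v+L$ differ only by a set of Lebesgue measure $0$. Here a star body is a bounded set $L$ that is star-shaped with respect to the origin, contains the origin in its interior, and whose radial function $\rho_L(x) = \sup\{\lambda \ge 0 : \lambda x \in L\}$ is continuous on $\mathbb{R}^n \setminus \{0\}$. -/

import Mathlib

open MeasureTheory
open scoped ENNReal

/-!
The space `ℝⁿ` is modelled by `Fin n → ℝ` with Lebesgue measure `volume`. Only its linear structure,
its topology, its bounded sets, its Borel sets and Lebesgue measure are used below, and none of
these depends on the choice of a norm on `ℝⁿ`.
-/

namespace AnisoFrac

/-- A convex body: a compact convex set with non-empty interior. -/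
structure IsConvexBody {n : ℕ} (K : Set (Fin n → ℝ)) : Prop where
  isCompact : IsCompact K
  convex : Convex ℝ K
  interior_nonempty : (interior K).Nonempty

/-- The reflection in the coordinate hyperplane `{x | x i = 0}`. -/
def coordReflection {n : ℕ} (i : Fin n) (x : Fin n → ℝ) : Fin n → ℝ :=
  Function.update x i (-(x i))

/-- A set is unconditional if it is symmetric in every coordinate hyperplane. -/
def IsUnconditional {n : ℕ} (A : Set (Fin n → ℝ)) : Prop :=
  ∀ i : Fin n, coordReflection i '' A = A

/-- The radial function `ρ_L(x) = sup {t ≥ 0 | t x ∈ L}`. It is used only for `x ≠ 0` and for bounded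
star-shaped sets `L` that contain the origin, where the set on the right is non-empty and bounded. -/
noncomputable def radialFun {n : ℕ} (L : Set (Fin n → ℝ)) (x : Fin n → ℝ) : ℝ :=
  sSup {t : ℝ | 0 ≤ t ∧ t • x ∈ L}

/-- A star body: a bounded set, star-shaped with respect to the origin, that contains the origin in
its interior and whose radial function is continuous (on `ℝⁿ` without the origin). -/
structure IsStarBody {n : ℕ} (L : Set (Fin n → ℝ)) : Prop where
  isBounded : Bornology.IsBounded L
  starShaped : StarConvex ℝ 0 L
  zero_mem_interior : (0 : Fin n → ℝ) ∈ interior L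
  continuousOn_radialFun : ContinuousOn (radialFun L) {x | x ≠ 0}

/-- The anisotropic fractional `s`-perimeter
`P_s(E, K) = ∫_E ∫_{Eᶜ} ‖x - y‖_K ^ (-(n + s)) dy dx`, with values in `[0, ∞]`. Here `gauge K` is the
norm with closed unit ball `K`. -/
noncomputable def fracPerimeter {n : ℕ} (s : ℝ) (K E : Set (Fin n → ℝ)) : ℝ≥0∞ :=
  ∫⁻ x in E, ∫⁻ y in Eᶜ, ENNReal.ofReal (1 / gauge K (x - y) ^ ((n : ℝ) + s))

/-- The optimal constant `γ_{n,s}(K)` of the anisotropic fractional isoperimetric inequality: the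
largest `c` such that `P_s(E, K) ≥ c |E| ^ ((n - s) / n)` for all bounded Borel sets `E`. -/
noncomputable def isoConst {n : ℕ} (s : ℝ) (K : Set (Fin n → ℝ)) : ℝ≥0∞ :=
  sSup {c : ℝ≥0∞ | ∀ E : Set (Fin n → ℝ), Bornology.IsBounded E → MeasurableSet E →
    c * volume E ^ (((n : ℝ) - s) / n) ≤ fracPerimeter s K E}

/-- A minimizer of the anisotropic fractional isoperimetric inequality: a bounded Borel set of
positive measure for which equality holds with the optimal constant. -/
structure IsIsoMinimizer {n : ℕ} (s : ℝ) (K M : Set (Fin n → ℝ)) : Prop where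
  isBounded : Bornology.IsBounded M
  measurableSet : MeasurableSet M
  volume_pos : 0 < volume M
  eq : fracPerimeter s K M = isoConst s K * volume M ^ (((n : ℝ) - s) / n)

end AnisoFrac

/-! The proof uses polarization (two-point symmetrization) in the hyperplanes `x i = c`. Polarizing
preserves volume. It does not increase the perimeter: unconditionality leaves only two kernel values
for the four pairs obtained from `(x, y)` by reflection, and strict convexity makes the same-side
value strictly larger (`gauge_lt_of_abs_lt`). A minimizer has finite perimeter, by comparison with a
ball, so equality in the polarization inequality forces, for every `i` and `c`, one half of `M` to
reflect into the other up to a null set (`IsIsoMinimizer.reflect_dichotomy`).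

The first moment about `x i = c` decides which half it is: beyond the barycenter the outer part
reflects inwards, and at the barycenter `M` is symmetric. Composing two such reflections gives
translations, so moving a point of `M` towards the coordinate hyperplanes through the barycenter
keeps it in `M` almost surely (`ReflectDichotomy.ae_shift`). By Fubini, almost every point of the
centred set spans a coordinate box lying in that set up to a null set. The union of all such boxes
is an open solid representative (`ShiftInvariant.boxHull_ae_eq`), and bounded open non-empty solid
sets are unconditional star bodies (`IsSolid.isStarBody`). -/

namespace AnisoFrac

open Set Filter Topology

variable {n : ℕ}

/-! ### Reflections and folding of integrals onto a half-space. -/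

/-- The reflection in the hyperplane `{x | x i = c}`. -/
def hypReflect (i : Fin n) (c : ℝ) (x : Fin n → ℝ) : Fin n → ℝ :=
  Function.update x i (2 * c - x i)

@[simp] lemma hypReflect_self (i : Fin n) (c : ℝ) (x : Fin n → ℝ) :
    hypReflect i c x i = 2 * c - x i := by simp [hypReflect]

lemma hypReflect_of_ne {i j : Fin n} (h : j ≠ i) (c : ℝ) (x : Fin n → ℝ) :
    hypReflect i c x j = x j := by simp [hypReflect, h]

@[simp] lemma hypReflect_hypReflect (i : Fin n) (c : ℝ) (x : Fin n → ℝ) :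
    hypReflect i c (hypReflect i c x) = x := by
  ext j
  by_cases h : j = i
  · subst h; simp
  · simp [hypReflect_of_ne h]

lemma measurePreserving_hypReflect (i : Fin n) (c : ℝ) :
    MeasurePreserving (hypReflect i c) := by
  have h : ∀ j : Fin n, MeasurePreserving
      (fun t : ℝ => if j = i then 2 * c - t else t) := by
    intro j
    by_cases hj : j = i
    · simpa [hj] using Measure.measurePreserving_sub_left (volume : Measure ℝ) (2 * c)
    · simp only [hj, if_false]
      exact MeasurePreserving.id (volume : Measure ℝ)
  convert volume_preserving_pi h using 1
  ext x j
  by_cases hj : j = i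
  · subst hj; simp
  · simp [hypReflect_of_ne hj, hj]

lemma measurable_hypReflect (i : Fin n) (c : ℝ) : Measurable (hypReflect i c) :=
  (measurePreserving_hypReflect i c).measurable

/-- The reflection as a measurable equivalence. -/
def hypReflectEquiv (i : Fin n) (c : ℝ) : (Fin n → ℝ) ≃ᵐ (Fin n → ℝ) where
  toFun := hypReflect i c
  invFun := hypReflect i c
  left_inv := hypReflect_hypReflect i c
  right_inv := hypReflect_hypReflect i c
  measurable_toFun := measurable_hypReflect i c
  measurable_invFun := measurable_hypReflect i c

lemma measurableEmbedding_hypReflect (i : Fin n) (c : ℝ) :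
    MeasurableEmbedding (hypReflect i c) := (hypReflectEquiv i c).measurableEmbedding

/-- The open half-space `{x | c < x i}`. -/
def halfSpace (i : Fin n) (c : ℝ) : Set (Fin n → ℝ) := {x | c < x i}

@[simp] lemma mem_halfSpace {i : Fin n} {c : ℝ} {x : Fin n → ℝ} :
    x ∈ halfSpace i c ↔ c < x i := Iff.rfl

lemma measurableSet_halfSpace (i : Fin n) (c : ℝ) : MeasurableSet (halfSpace i c) :=
  measurableSet_lt measurable_const (measurable_pi_apply i)

lemma ae_ne_hyperplane (i : Fin n) (c : ℝ) : ∀ᵐ x : Fin n → ℝ, x i ≠ c :=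
  compl_mem_ae_iff.2 (Measure.pi_hyperplane (fun _ => (volume : Measure ℝ)) i c)

lemma halfSpace_compl_ae (i : Fin n) (c : ℝ) :
    (halfSpace i c)ᶜ =ᵐ[volume] hypReflect i c ⁻¹' halfSpace i c := by
  filter_upwards [ae_ne_hyperplane i c] with x hx
  refine propext ⟨fun h => ?_, fun h => ?_⟩
  · have h' : ¬ c < x i := h
    change c < hypReflect i c x i
    rw [hypReflect_self]
    have := lt_of_le_of_ne (not_lt.1 h') hx
    linarith
  · have h' : c < hypReflect i c x i := h
    rw [hypReflect_self] at h'
    change ¬ c < x i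
    linarith

lemma lintegral_eq_fold (i : Fin n) (c : ℝ) {f : (Fin n → ℝ) → ℝ≥0∞} (hf : Measurable f) :
    ∫⁻ x, f x = ∫⁻ x in halfSpace i c, (f x + f (hypReflect i c x)) := by
  rw [lintegral_add_left hf, ← lintegral_add_compl f (measurableSet_halfSpace i c)]
  congr 1
  refine (setLIntegral_congr (halfSpace_compl_ae i c)).trans ?_
  have := (measurePreserving_hypReflect i c).setLIntegral_comp_preimage_emb
    (measurableEmbedding_hypReflect i c) (fun x => f (hypReflect i c x)) (halfSpace i c)
  simpa using this

lemma integral_eq_fold (i : Fin n) (c : ℝ) {f : (Fin n → ℝ) → ℝ} (hf : Integrable f) :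
    ∫ x, f x = ∫ x in halfSpace i c, (f x + f (hypReflect i c x)) := by
  have hf' : Integrable (fun x => f (hypReflect i c x)) :=
    (measurePreserving_hypReflect i c).integrable_comp_of_integrable hf
  rw [integral_add hf.integrableOn hf'.integrableOn,
    ← integral_add_compl (measurableSet_halfSpace i c) hf]
  congr 1
  refine (setIntegral_congr_set (halfSpace_compl_ae i c)).trans ?_
  have := (measurePreserving_hypReflect i c).setIntegral_preimage_emb
    (measurableEmbedding_hypReflect i c) (fun x => f (hypReflect i c x)) (halfSpace i c)
  simpa using this

lemma lintegral_lintegral_eq_fold (i : Fin n) (c : ℝ) {f : (Fin n → ℝ) → (Fin n → ℝ) → ℝ≥0∞}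
    (hf : Measurable (Function.uncurry f)) :
    ∫⁻ x, ∫⁻ y, f x y = ∫⁻ x in halfSpace i c, ∫⁻ y in halfSpace i c,
      (f x y + f x (hypReflect i c y) +
        (f (hypReflect i c x) y + f (hypReflect i c x) (hypReflect i c y))) := by
  have hr := measurable_hypReflect i c
  have h1 : ∀ x, ∫⁻ y, f x y = ∫⁻ y in halfSpace i c, (f x y + f x (hypReflect i c y)) :=
    fun x => lintegral_eq_fold i c (hf.of_uncurry_left (x := x))
  refine (lintegral_eq_fold i c (f := fun x => ∫⁻ y, f x y) hf.lintegral_prod_right').trans ?_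
  refine lintegral_congr fun x => ?_
  rw [h1, h1]
  exact (lintegral_add_left
    ((hf.of_uncurry_left (x := x)).add ((hf.of_uncurry_left (x := x)).comp hr)) _).symm

/-! ### Symmetry and strict monotonicity of the kernel. -/

section Kernel

variable {K : Set (Fin n → ℝ)}

lemma coordReflection_mem (hKunc : IsUnconditional K) (i : Fin n) {x : Fin n → ℝ} (hx : x ∈ K) :
    coordReflection i x ∈ K := by
  have := hKunc i
  rw [← this]
  exact mem_image_of_mem _ hx

lemma IsUnconditional.neg_mem (hKunc : IsUnconditional K) {x : Fin n → ℝ} (hx : x ∈ K) :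
    -x ∈ K := by
  classical
  have : ∀ S : Finset (Fin n), (fun j => if j ∈ S then -(x j) else x j) ∈ K := by
    intro S
    induction S using Finset.induction_on with
    | empty => simpa using hx
    | insert i S hi ih =>
      convert coordReflection_mem hKunc i ih using 1
      ext j
      by_cases hj : j = i
      · subst hj; simp [coordReflection, hi]
      · simp [coordReflection, hj]
  simpa [Pi.neg_def] using this Finset.univ

lemma IsConvexBody.mem_nhds_zero (hK : IsConvexBody K) (hKunc : IsUnconditional K) :
    K ∈ 𝓝 (0 : Fin n → ℝ) := by
  obtain ⟨x, hx⟩ := hK.interior_nonempty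
  have hneg : -x ∈ K := hKunc.neg_mem (interior_subset hx)
  have := hK.convex.combo_interior_self_mem_interior hx hneg (a := 1 / 2) (b := 1 / 2)
    (by norm_num) (by norm_num) (by norm_num)
  rw [mem_interior_iff_mem_nhds] at this
  simpa using this

lemma gauge_coordReflection (hKunc : IsUnconditional K) (i : Fin n) (x : Fin n → ℝ) :
    gauge K (coordReflection i x) = gauge K x := by
  have hinv : ∀ x : Fin n → ℝ, coordReflection i (coordReflection i x) = x := by
    intro x; simp [coordReflection]
  have hsm : ∀ (r : ℝ) (x : Fin n → ℝ), r • coordReflection i x = coordReflection i (r • x) := by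
    intro r x
    ext j
    by_cases hj : j = i
    · subst hj; simp [coordReflection]
    · simp [coordReflection, hj]
  have hiff : ∀ x : Fin n → ℝ, coordReflection i x ∈ K ↔ x ∈ K := fun x =>
    ⟨fun h => by simpa [hinv] using coordReflection_mem hKunc i h, coordReflection_mem hKunc i⟩
  simp only [gauge_def', hsm, hiff]

/-- The point `y` and its mirror image lie on the same gauge sphere, and `x` is strictly between
them on the segment that joins them. Strict convexity pushes it into the interior of the scaled
body. -/
lemma gauge_lt_of_abs_lt (hK : IsConvexBody K) (hKs : StrictConvex ℝ K)
    (hKunc : IsUnconditional K) (i : Fin n) {x y : Fin n → ℝ} (hxy : ∀ j ≠ i, x j = y j)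
    (hi : |x i| < |y i|) : gauge K x < gauge K y := by
  have h0 := hK.mem_nhds_zero hKunc
  have habs : Absorbent ℝ K := absorbent_nhds_zero h0
  have hb : Bornology.IsVonNBounded ℝ K :=
    (NormedSpace.isVonNBounded_iff ℝ).2 hK.isCompact.isBounded
  have hyi : y i ≠ 0 := by
    rintro h
    rw [h, abs_zero] at hi
    exact absurd hi (not_lt.2 (abs_nonneg _))
  have hy0 : y ≠ 0 := by rintro rfl; exact hyi rfl
  set r := gauge K y with hr
  have hrpos : 0 < r := (gauge_pos habs hb).2 hy0
  have hmem : ∀ z, gauge K z = r → r⁻¹ • z ∈ K := by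
    intro z hz
    have : gauge K (r⁻¹ • z) ≤ 1 := by
      rw [gauge_smul_of_nonneg (by positivity), hz, smul_eq_mul, inv_mul_cancel₀ hrpos.ne']
    rw [gauge_le_one_iff_mem_closure hK.convex h0, hK.isCompact.isClosed.closure_eq] at this
    exact this
  have hA := hmem y rfl
  have hB := hmem (coordReflection i y) (gauge_coordReflection hKunc i y)
  have hne : r⁻¹ • y ≠ r⁻¹ • coordReflection i y := by
    intro h
    have := smul_right_injective _ (inv_ne_zero hrpos.ne') h
    have := congrFun this i
    simp only [coordReflection, Function.update_self] at this
    exact hyi (by linarith)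
  set t := x i / y i with ht
  have htabs : |t| < 1 := by
    rw [ht, abs_div, div_lt_one (abs_pos.2 hyi)]; exact hi
  rw [abs_lt] at htabs
  have hint := hKs hA hB hne (a := (1 + t) / 2) (b := (1 - t) / 2) (by linarith) (by linarith)
    (by ring)
  rw [← gauge_lt_one_iff_mem_interior hK.convex h0] at hint
  have hx : ((1 + t) / 2) • r⁻¹ • y + ((1 - t) / 2) • r⁻¹ • coordReflection i y = r⁻¹ • x := by
    ext j
    by_cases hj : j = i
    · subst hj
      simp only [Pi.add_apply, Pi.smul_apply, smul_eq_mul, coordReflection, Function.update_self]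
      have : x j = t * y j := by rw [ht]; field_simp
      rw [this]; ring
    · simp only [Pi.add_apply, Pi.smul_apply, smul_eq_mul, coordReflection,
        Function.update_of_ne hj, hxy j hj]
      ring
  rw [hx, gauge_smul_of_nonneg (by positivity), smul_eq_mul, inv_mul_lt_iff₀ hrpos, mul_one] at hint
  exact hint

/-- The kernel `‖z‖_K ^ (-(n + s))`. -/
noncomputable def kernel (s : ℝ) (K : Set (Fin n → ℝ)) (z : Fin n → ℝ) : ℝ≥0∞ :=
  ENNReal.ofReal (1 / gauge K z ^ ((n : ℝ) + s))

lemma measurable_kernel (hK : IsConvexBody K) (hKunc : IsUnconditional K) (s : ℝ) :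
    Measurable (kernel s K) := by
  have hg : Measurable (gauge K) :=
    (continuous_gauge hK.convex (hK.mem_nhds_zero hKunc)).measurable
  unfold kernel
  fun_prop

lemma kernel_congr (hKunc : IsUnconditional K) (s : ℝ) (i : Fin n) {x y : Fin n → ℝ}
    (hxy : ∀ j ≠ i, x j = y j) (hi : |x i| = |y i|) : kernel s K x = kernel s K y := by
  rcases abs_eq_abs.1 hi with h | h
  · have : x = y := by
      ext j
      by_cases hj : j = i
      · rw [hj, h]
      · exact hxy j hj
    rw [this]
  · have : x = coordReflection i y := by
      ext j
      by_cases hj : j = i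
      · subst hj; simp [coordReflection, h]
      · simp [coordReflection, hj, hxy j hj]
    rw [this, kernel, kernel, gauge_coordReflection hKunc]

/-- The condition `x ≠ 0` matters: with `1 / 0 = 0` the kernel takes the value `0` at the origin,
not `∞`. -/
lemma kernel_lt_of_abs_lt (hK : IsConvexBody K) (hKs : StrictConvex ℝ K)
    (hKunc : IsUnconditional K) {s : ℝ} (hs : 0 < s) (i : Fin n) {x y : Fin n → ℝ}
    (hx : x ≠ 0) (hxy : ∀ j ≠ i, x j = y j)
    (hi : |x i| < |y i|) : kernel s K y < kernel s K x := by
  have h0 := hK.mem_nhds_zero hKunc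
  have hb : Bornology.IsVonNBounded ℝ K :=
    (NormedSpace.isVonNBounded_iff ℝ).2 hK.isCompact.isBounded
  have hpos : 0 < gauge K x := (gauge_pos (absorbent_nhds_zero h0) hb).2 hx
  have hlt := gauge_lt_of_abs_lt hK hKs hKunc i hxy hi
  have hp : 0 < (n : ℝ) + s := by positivity
  have hxp : 0 < gauge K x ^ ((n : ℝ) + s) := Real.rpow_pos_of_pos hpos _
  unfold kernel
  rw [ENNReal.ofReal_lt_ofReal_iff (by positivity)]
  exact one_div_lt_one_div_of_lt hxp (Real.rpow_lt_rpow hpos.le hlt hp)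

end Kernel

/-! ### Polarization and its effect on the perimeter. -/

section

/-- The polarization of `E` with respect to the hyperplane `{x | x i = c}`, towards `{x | c < x i}`. -/
def polarize (i : Fin n) (c : ℝ) (E : Set (Fin n → ℝ)) : Set (Fin n → ℝ) :=
  (halfSpace i c ∩ (E ∪ hypReflect i c ⁻¹' E)) ∪ ((halfSpace i c)ᶜ ∩ (E ∩ hypReflect i c ⁻¹' E))

section Polarize

variable {i : Fin n} {c : ℝ} {E : Set (Fin n → ℝ)}

lemma mem_polarize_of_mem {x : Fin n → ℝ} (hx : x ∈ halfSpace i c) :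
    x ∈ polarize i c E ↔ x ∈ E ∨ hypReflect i c x ∈ E := by
  simp only [polarize, mem_union, mem_inter_iff, mem_compl_iff, hx, mem_preimage]
  tauto

lemma hypReflect_notMem_halfSpace {x : Fin n → ℝ} (hx : x ∈ halfSpace i c) :
    hypReflect i c x ∉ halfSpace i c := by
  simp only [mem_halfSpace, hypReflect_self] at *
  linarith

lemma hypReflect_mem_polarize {x : Fin n → ℝ} (hx : x ∈ halfSpace i c) :
    hypReflect i c x ∈ polarize i c E ↔ x ∈ E ∧ hypReflect i c x ∈ E := by
  simp only [polarize, mem_union, mem_inter_iff, mem_compl_iff, hypReflect_notMem_halfSpace hx,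
    mem_preimage, hypReflect_hypReflect]
  tauto

lemma measurableSet_polarize (hE : MeasurableSet E) : MeasurableSet (polarize i c E) :=
  ((measurableSet_halfSpace i c).inter (hE.union (measurable_hypReflect i c hE))).union
    ((measurableSet_halfSpace i c).compl.inter (hE.inter (measurable_hypReflect i c hE)))

lemma isBounded_polarize (hE : Bornology.IsBounded E) : Bornology.IsBounded (polarize i c E) := by
  have h : Bornology.IsBounded (hypReflect i c ⁻¹' E) := by
    have hiso : Isometry (hypReflect i c) := by
      refine Isometry.of_dist_eq fun x y => ?_
      simp only [dist_pi_def]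
      congr 2
      ext j
      by_cases hj : j = i
      · subst hj; simp [Real.dist_eq]
      · simp [hypReflect_of_ne hj]
    exact hiso.antilipschitz.isBounded_preimage hE
  refine (hE.union h).subset ?_
  rintro x (⟨-, hx⟩ | ⟨-, hx⟩)
  · exact hx
  · exact Or.inl hx.1

lemma volume_polarize (hE : MeasurableSet E) : volume (polarize i c E) = volume E := by
  classical
  rw [← lintegral_indicator_one hE, ← lintegral_indicator_one (measurableSet_polarize hE),
    lintegral_eq_fold i c (measurable_one.indicator hE),
    lintegral_eq_fold i c (measurable_one.indicator (measurableSet_polarize hE))]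
  refine setLIntegral_congr_fun (measurableSet_halfSpace i c) fun x hx => ?_
  simp only [indicator_apply, mem_polarize_of_mem hx, hypReflect_mem_polarize hx, Pi.one_apply]
  by_cases h1 : x ∈ E <;> by_cases h2 : hypReflect i c x ∈ E <;> simp [h1, h2]

end Polarize

open Classical in
/-- The integrand of the fractional perimeter, as a function on the whole product space. -/
noncomputable def interaction (s : ℝ) (K E : Set (Fin n → ℝ)) (x y : Fin n → ℝ) : ℝ≥0∞ :=
  if x ∈ E ∧ y ∉ E then kernel s K (x - y) else 0

/-- The sum of the interactions of the four pairs obtained from `(x, y)` by reflection. -/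
noncomputable def foldedInteraction (s : ℝ) (K E : Set (Fin n → ℝ)) (i : Fin n) (c : ℝ)
    (x y : Fin n → ℝ) : ℝ≥0∞ :=
  interaction s K E x y + interaction s K E x (hypReflect i c y) +
    (interaction s K E (hypReflect i c x) y +
      interaction s K E (hypReflect i c x) (hypReflect i c y))

variable {K E : Set (Fin n → ℝ)} {s : ℝ}

lemma fracPerimeter_eq_interaction (hE : MeasurableSet E) :
    fracPerimeter s K E = ∫⁻ x, ∫⁻ y, interaction s K E x y := by
  unfold fracPerimeter
  rw [← lintegral_indicator hE]
  refine lintegral_congr fun x => ?_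
  by_cases hx : x ∈ E
  · rw [indicator_of_mem hx, ← lintegral_indicator hE.compl]
    refine lintegral_congr fun y => ?_
    by_cases hy : y ∈ E <;> simp [interaction, hx, hy, kernel]
  · simp [interaction, hx]

lemma measurable_interaction (hK : IsConvexBody K) (hKunc : IsUnconditional K)
    (hE : MeasurableSet E) : Measurable (Function.uncurry (interaction s K E)) := by
  unfold interaction Function.uncurry
  refine Measurable.ite ?_ ?_ measurable_const
  · exact (measurable_fst hE).inter (measurable_snd hE.compl)
  · exact (measurable_kernel hK hKunc s).comp (measurable_fst.sub measurable_snd)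

lemma measurable_foldedInteraction (hK : IsConvexBody K) (hKunc : IsUnconditional K)
    (hE : MeasurableSet E) (i : Fin n) (c : ℝ) :
    Measurable (Function.uncurry (foldedInteraction s K E i c)) := by
  have h := measurable_interaction (s := s) hK hKunc hE
  have hr := measurable_hypReflect i c
  have h2 : Measurable fun p : (Fin n → ℝ) × (Fin n → ℝ) => (p.1, hypReflect i c p.2) := by fun_prop
  have h3 : Measurable fun p : (Fin n → ℝ) × (Fin n → ℝ) => (hypReflect i c p.1, p.2) := by fun_prop
  have h4 : Measurable fun p : (Fin n → ℝ) × (Fin n → ℝ) =>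
    (hypReflect i c p.1, hypReflect i c p.2) := by fun_prop
  exact (h.add (h.comp h2)).add ((h.comp h3).add (h.comp h4))

lemma fracPerimeter_eq_folded (hK : IsConvexBody K) (hKunc : IsUnconditional K)
    (hE : MeasurableSet E) (i : Fin n) (c : ℝ) :
    fracPerimeter s K E = ∫⁻ p, Function.uncurry (foldedInteraction s K E i c) p
      ∂((volume.restrict (halfSpace i c)).prod (volume.restrict (halfSpace i c))) := by
  rw [fracPerimeter_eq_interaction hE,
    lintegral_lintegral_eq_fold i c (measurable_interaction hK hKunc hE),
    lintegral_prod _ (measurable_foldedInteraction hK hKunc hE i c).aemeasurable]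
  rfl

open Classical in
-- By unconditionality the four differences share two kernel values, one for points on the same side
-- and one for points on opposite sides.
lemma foldedInteraction_eq (hKunc : IsUnconditional K) (i : Fin n) (c : ℝ) (x y : Fin n → ℝ) :
    foldedInteraction s K E i c x y =
      (if x ∈ E ∧ y ∉ E then kernel s K (x - y) else 0) +
      (if x ∈ E ∧ hypReflect i c y ∉ E then kernel s K (x - hypReflect i c y) else 0) +
      ((if hypReflect i c x ∈ E ∧ y ∉ E then kernel s K (x - hypReflect i c y) else 0) +
      (if hypReflect i c x ∈ E ∧ hypReflect i c y ∉ E then kernel s K (x - y) else 0)) := by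
  have h1 : kernel s K (hypReflect i c x - y) = kernel s K (x - hypReflect i c y) := by
    refine kernel_congr hKunc s i (fun j hj => ?_) ?_
    · simp [hypReflect_of_ne hj]
    · simp only [Pi.sub_apply, hypReflect_self]
      rw [← abs_neg]; congr 1; ring
  have h2 : kernel s K (hypReflect i c x - hypReflect i c y) = kernel s K (x - y) := by
    refine kernel_congr hKunc s i (fun j hj => ?_) ?_
    · simp [hypReflect_of_ne hj]
    · simp only [Pi.sub_apply, hypReflect_self]
      rw [← abs_neg]; congr 1; ring
  simp only [foldedInteraction, interaction, h1, h2]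

lemma kernel_sub_hypReflect_lt (hK : IsConvexBody K) (hKs : StrictConvex ℝ K)
    (hKunc : IsUnconditional K) (hs : 0 < s) {i : Fin n} {c : ℝ} {x y : Fin n → ℝ}
    (hx : x ∈ halfSpace i c) (hy : y ∈ halfSpace i c) (hxy : x ≠ y) :
    kernel s K (x - hypReflect i c y) < kernel s K (x - y) := by
  refine kernel_lt_of_abs_lt hK hKs hKunc hs i (sub_ne_zero.2 hxy) (fun j hj => ?_) ?_
  · simp [hypReflect_of_ne hj]
  · simp only [Pi.sub_apply, hypReflect_self, mem_halfSpace] at *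
    rw [abs_lt]
    have : x i - (2 * c - y i) ≤ |x i - (2 * c - y i)| := le_abs_self _
    constructor <;> linarith

/-- The value can change only if exactly one of `x`, `σ x` and exactly one of `y`, `σ y` is in `E`,
on opposite sides of the hyperplane. Polarization then puts both on the same side and replaces the
kernel at `x - y` by the smaller one at `x - σ y`. -/
lemma foldedInteraction_polarize_le (hK : IsConvexBody K) (hKs : StrictConvex ℝ K)
    (hKunc : IsUnconditional K) (hs : 0 < s) {i : Fin n} {c : ℝ} {x y : Fin n → ℝ}
    (hx : x ∈ halfSpace i c) (hy : y ∈ halfSpace i c) :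
    foldedInteraction s K (polarize i c E) i c x y ≤ foldedInteraction s K E i c x y := by
  classical
  rw [foldedInteraction_eq hKunc, foldedInteraction_eq hKunc]
  simp only [mem_polarize_of_mem hx, mem_polarize_of_mem hy, hypReflect_mem_polarize hx,
    hypReflect_mem_polarize hy]
  -- On the diagonal the kernel comparison fails because of the value `0` at the origin, but the
  -- critical configuration cannot occur there.
  by_cases hxy : x = y
  · subst hxy
    by_cases h1 : x ∈ E <;> by_cases h2 : hypReflect i c x ∈ E <;> simp [h1, h2]
  · have hlt := (kernel_sub_hypReflect_lt hK hKs hKunc hs hx hy hxy).le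
    by_cases h1 : x ∈ E <;> by_cases h2 : hypReflect i c x ∈ E <;>
      by_cases h3 : y ∈ E <;> by_cases h4 : hypReflect i c y ∈ E <;>
      simp [h1, h2, h3, h4, hlt, add_comm]

lemma foldedInteraction_polarize_lt (hK : IsConvexBody K) (hKs : StrictConvex ℝ K)
    (hKunc : IsUnconditional K) (hs : 0 < s) {i : Fin n} {c : ℝ} {x y : Fin n → ℝ}
    (hx : x ∈ halfSpace i c) (hy : y ∈ halfSpace i c) (h1 : x ∈ E) (h2 : hypReflect i c x ∉ E)
    (h3 : y ∉ E) (h4 : hypReflect i c y ∈ E) :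
    foldedInteraction s K (polarize i c E) i c x y < foldedInteraction s K E i c x y := by
  classical
  rw [foldedInteraction_eq hKunc, foldedInteraction_eq hKunc]
  simp only [mem_polarize_of_mem hx, mem_polarize_of_mem hy, hypReflect_mem_polarize hx,
    hypReflect_mem_polarize hy]
  have hxy : x ≠ y := fun h => h3 (h ▸ h1)
  simpa [h1, h2, h3, h4] using kernel_sub_hypReflect_lt hK hKs hKunc hs hx hy hxy

lemma fracPerimeter_polarize_le (hK : IsConvexBody K) (hKs : StrictConvex ℝ K)
    (hKunc : IsUnconditional K) (hs : 0 < s) (hE : MeasurableSet E) (i : Fin n) (c : ℝ) :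
    fracPerimeter s K (polarize i c E) ≤ fracPerimeter s K E := by
  rw [fracPerimeter_eq_folded hK hKunc (measurableSet_polarize hE) i c,
    fracPerimeter_eq_folded hK hKunc hE i c, Measure.prod_restrict]
  refine setLIntegral_mono' ((measurableSet_halfSpace i c).prod (measurableSet_halfSpace i c)) ?_
  rintro ⟨x, y⟩ ⟨hx, hy⟩
  exact foldedInteraction_polarize_le hK hKs hKunc hs hx hy

/-- If polarization does not decrease a finite fractional perimeter, then the set is, up to null
sets, either its polarization or the reflection of its polarization. -/
lemma null_or_null_of_fracPerimeter_polarize_ge (hK : IsConvexBody K) (hKs : StrictConvex ℝ K)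
    (hKunc : IsUnconditional K) (hs : 0 < s) (hE : MeasurableSet E) (i : Fin n) (c : ℝ)
    (hfin : fracPerimeter s K E ≠ ∞)
    (hge : fracPerimeter s K E ≤ fracPerimeter s K (polarize i c E)) :
    volume (halfSpace i c ∩ (E \ hypReflect i c ⁻¹' E)) = 0 ∨
      volume (halfSpace i c ∩ (hypReflect i c ⁻¹' E \ E)) = 0 := by
  have hE' := measurableSet_polarize (i := i) (c := c) hE
  have hH := measurableSet_halfSpace i c
  have hr := measurable_hypReflect i c hE
  have hle := fracPerimeter_polarize_le (s := s) hK hKs hKunc hs hE i c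
  have hfin' : fracPerimeter s K (polarize i c E) ≠ ∞ := ne_top_of_le_ne_top hfin hle
  rw [fracPerimeter_eq_folded hK hKunc hE' i c, fracPerimeter_eq_folded hK hKunc hE i c,
    Measure.prod_restrict] at hge
  rw [fracPerimeter_eq_folded hK hKunc hE' i c, Measure.prod_restrict] at hfin'
  have hae := ae_eq_of_ae_le_of_lintegral_le
    ((ae_restrict_mem (hH.prod hH)).mono fun p hp =>
      foldedInteraction_polarize_le hK hKs hKunc hs hp.1 hp.2) hfin'
    (measurable_foldedInteraction hK hKunc hE i c).aemeasurable hge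
  -- On the product of the two sets the folded integrands differ strictly, so this product is null
  -- and one of its factors is.
  rw [← mul_eq_zero, ← Measure.prod_prod]
  rw [EventuallyEq, ae_restrict_iff' (hH.prod hH)] at hae
  refine measure_mono_null ?_ hae
  rintro ⟨x, y⟩ ⟨⟨hx, hx1, hx2⟩, ⟨hy, hy1, hy2⟩⟩ h
  exact (foldedInteraction_polarize_lt hK hKs hKunc hs hx hy hx1 hx2 hy2 hy1).ne (h ⟨hx, hy⟩)

end

/-! ### Finite perimeter of the unit ball of the sup norm. -/

section Finiteness

lemma lintegral_norm_rpow_neg_lt_top {p : ℝ} (hp : (n : ℝ) < p) :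
    ∫⁻ z : Fin n → ℝ, {z : Fin n → ℝ | 1 ≤ ‖z‖}.indicator
      (fun z => ENNReal.ofReal (‖z‖ ^ (-p))) z < ∞ := by
  have hp0 : 0 < p := (Nat.cast_nonneg n).trans_lt hp
  have h := finite_integral_one_add_norm (E := Fin n → ℝ) (μ := volume) (r := p)
    (by simpa using hp)
  -- For `1 ≤ ‖z‖` one has `1 + ‖z‖ ≤ 2 * ‖z‖`, which is the source of the factor `2 ^ p`.
  refine (lintegral_mono (g := fun z : Fin n → ℝ =>
    ENNReal.ofReal (2 ^ p) * ENNReal.ofReal ((1 + ‖z‖) ^ (-p))) fun z => ?_).trans_lt ?_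
  · refine indicator_apply_le' (fun hz => ?_) (fun _ => zero_le)
    have hz : 1 ≤ ‖z‖ := hz
    have hz0 : 0 < ‖z‖ := by linarith
    beta_reduce
    rw [← ENNReal.ofReal_mul (by positivity)]
    refine ENNReal.ofReal_le_ofReal ?_
    have h1 : ‖z‖ ^ (-p) = 2 ^ p * (2 * ‖z‖) ^ (-p) := by
      rw [Real.mul_rpow (by norm_num) hz0.le, ← mul_assoc, ← Real.rpow_add (by norm_num)]
      simp
    rw [h1]
    refine mul_le_mul_of_nonneg_left ?_ (by positivity)
    exact Real.rpow_le_rpow_of_nonpos (by positivity) (by linarith) (by linarith)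
  · rw [lintegral_const_mul' _ _ ENNReal.ofReal_ne_top]
    exact ENNReal.mul_lt_top ENNReal.ofReal_lt_top h

lemma lintegral_norm_rpow_neg_scale {p d : ℝ} (hd : 0 < d) :
    ∫⁻ z : Fin n → ℝ, {z : Fin n → ℝ | d ≤ ‖z‖}.indicator
      (fun z => ENNReal.ofReal (‖z‖ ^ (-p))) z =
    ENNReal.ofReal (d ^ ((n : ℝ) - p)) * ∫⁻ z : Fin n → ℝ, {z : Fin n → ℝ | 1 ≤ ‖z‖}.indicator
      (fun z => ENNReal.ofReal (‖z‖ ^ (-p))) z := by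
  set f : (Fin n → ℝ) → ℝ≥0∞ := {z : Fin n → ℝ | d ≤ ‖z‖}.indicator
      (fun z => ENNReal.ofReal (‖z‖ ^ (-p))) with hf
  have hfm : Measurable f := by
    refine Measurable.indicator (by fun_prop) ?_
    exact measurableSet_le measurable_const measurable_norm
  have h1 : ∫⁻ z, f z ∂(Measure.map (d • ·) (volume : Measure (Fin n → ℝ))) =
      ∫⁻ z, f (d • z) := lintegral_map hfm (measurable_const_smul d)
  rw [Measure.map_addHaar_smul _ hd.ne', lintegral_smul_measure, smul_eq_mul] at h1
  have h2 : ∀ z : Fin n → ℝ, f (d • z) = ENNReal.ofReal (d ^ (-p)) *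
      {z : Fin n → ℝ | 1 ≤ ‖z‖}.indicator (fun z => ENNReal.ofReal (‖z‖ ^ (-p))) z := by
    intro z
    have hn : ‖d • z‖ = d * ‖z‖ := by rw [norm_smul, Real.norm_of_nonneg hd.le]
    have hiff : d ≤ d * ‖z‖ ↔ 1 ≤ ‖z‖ := le_mul_iff_one_le_right hd
    by_cases hz : 1 ≤ ‖z‖
    · rw [hf, indicator_of_mem (by simpa [hn, hiff] using hz), indicator_of_mem (by simpa using hz),
        hn, Real.mul_rpow hd.le (norm_nonneg _), ENNReal.ofReal_mul (by positivity)]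
    · rw [hf, indicator_of_notMem (by simpa [hn, hiff] using hz),
        indicator_of_notMem (by simpa using hz), mul_zero]
  simp_rw [h2] at h1
  rw [lintegral_const_mul' _ _ ENNReal.ofReal_ne_top] at h1
  have hfr : Module.finrank ℝ (Fin n → ℝ) = n := by simp
  rw [hfr, abs_of_pos (by positivity)] at h1
  have h3 : ENNReal.ofReal (d ^ n) * ENNReal.ofReal ((d ^ n)⁻¹) = 1 := by
    rw [← ENNReal.ofReal_mul (by positivity), mul_inv_cancel₀ (by positivity), ENNReal.ofReal_one]
  calc ∫⁻ z, f z = ENNReal.ofReal (d ^ n) * (ENNReal.ofReal ((d ^ n)⁻¹) * ∫⁻ z, f z) := by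
        rw [← mul_assoc, h3, one_mul]
    _ = _ := by
        rw [h1, ← mul_assoc, ← ENNReal.ofReal_mul (by positivity), ← Real.rpow_natCast,
          ← Real.rpow_add hd]
        rfl

/-- Integration in the radius reduces this to `r ^ (n - 1) * (1 - r) ^ (-s)` on `(0, 1)`, integrable
because `s < 1`. -/
lemma lintegral_ball_one_sub_norm_rpow_lt_top (hn : 1 ≤ n) {s : ℝ} (hs1 : s < 1) :
    ∫⁻ x in Metric.ball (0 : Fin n → ℝ) 1, ENNReal.ofReal ((1 - ‖x‖) ^ (-s)) < ∞ := by
  have : Nonempty (Fin n) := ⟨⟨0, hn⟩⟩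
  have hint : IntegrableOn (fun y : ℝ => (1 - y) ^ (-s)) (Ioo 0 1) := by
    have h := (intervalIntegral.intervalIntegrable_rpow' (a := 0) (b := 1) (r := -s)
      (by linarith)).comp_sub_left (1 : ℝ)
    simp only [sub_zero, sub_self] at h
    exact ((intervalIntegrable_iff_integrableOn_Ioc_of_le zero_le_one).1 h.symm).mono_set
      Ioo_subset_Ioc_self
  have hint2 : IntegrableOn (fun y : ℝ => y ^ (Module.finrank ℝ (Fin n → ℝ) - 1) •
      (1 - y) ^ (-s)) (Ioo 0 1) := by
    refine Integrable.bdd_mul (c := 1) hint (by fun_prop) ?_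
    filter_upwards [ae_restrict_mem measurableSet_Ioo] with y hy
    rw [Real.norm_of_nonneg (pow_nonneg hy.1.le _)]
    exact pow_le_one₀ hy.1.le hy.2.le
  have := (integrableOn_fun_norm_addHaar (volume : Measure (Fin n → ℝ))
    (f := fun y : ℝ => (1 - y) ^ (-s)) (r := 1)).2 hint2
  refine lt_of_le_of_lt (lintegral_mono fun x => ?_) this.hasFiniteIntegral
  exact Real.ofReal_le_enorm _

lemma exists_kernel_le {K : Set (Fin n → ℝ)} (hK : IsConvexBody K) (hKunc : IsUnconditional K)
    {s : ℝ} (hs : 0 < s) :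
    ∃ C : ℝ, 0 ≤ C ∧ ∀ z : Fin n → ℝ,
      kernel s K z ≤ ENNReal.ofReal C * ENNReal.ofReal (‖z‖ ^ (-((n : ℝ) + s))) := by
  have h0 := hK.mem_nhds_zero hKunc
  obtain ⟨R, hR, hKR⟩ := hK.isCompact.isBounded.subset_closedBall_lt 0 (0 : Fin n → ℝ)
  have hp : 0 < (n : ℝ) + s := by positivity
  refine ⟨R ^ ((n : ℝ) + s), by positivity, fun z => ?_⟩
  rw [← ENNReal.ofReal_mul (by positivity)]
  refine ENNReal.ofReal_le_ofReal ?_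
  have hg := le_gauge_of_subset_closedBall (x := z) (absorbent_nhds_zero h0) hR.le hKR
  rcases eq_or_ne z 0 with rfl | hz
  · rw [gauge_zero, Real.zero_rpow hp.ne', div_zero]
    positivity
  · have hz' : 0 < ‖z‖ := norm_pos_iff.2 hz
    have hq : 0 < ‖z‖ / R := by positivity
    calc 1 / gauge K z ^ ((n : ℝ) + s) ≤ 1 / (‖z‖ / R) ^ ((n : ℝ) + s) :=
          one_div_le_one_div_of_le (Real.rpow_pos_of_pos hq _)
            (Real.rpow_le_rpow hq.le hg hp.le)
      _ = _ := by
          rw [Real.div_rpow hz'.le hR.le, Real.rpow_neg hz'.le, one_div_div, div_eq_mul_inv]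

/-- A point `x` of the ball has distance at least `1 - ‖x‖` from the complement, so by scaling the
inner integral is at most a multiple of `(1 - ‖x‖) ^ (-s)`. -/
lemma fracPerimeter_ball_lt_top (hn : 1 ≤ n) {K : Set (Fin n → ℝ)} (hK : IsConvexBody K)
    (hKunc : IsUnconditional K) {s : ℝ} (hs0 : 0 < s) (hs1 : s < 1) :
    fracPerimeter s K (Metric.ball 0 1) < ∞ := by
  obtain ⟨C, hC, hle⟩ := exists_kernel_le hK hKunc hs0
  set p : ℝ := (n : ℝ) + s with hp
  set J : ℝ≥0∞ := ∫⁻ z : Fin n → ℝ, {z : Fin n → ℝ | 1 ≤ ‖z‖}.indicator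
      (fun z => ENNReal.ofReal (‖z‖ ^ (-p))) z with hJdef
  have hJ : J < ∞ := lintegral_norm_rpow_neg_lt_top (by linarith)
  have hinner : ∀ x ∈ Metric.ball (0 : Fin n → ℝ) 1,
      ∫⁻ y in (Metric.ball (0 : Fin n → ℝ) 1)ᶜ, kernel s K (x - y) ≤
        ENNReal.ofReal C * J * ENNReal.ofReal ((1 - ‖x‖) ^ (-s)) := by
    intro x hx
    have hd : 0 < 1 - ‖x‖ := by
      have := mem_ball_zero_iff.1 hx
      linarith
    have hsc := lintegral_norm_rpow_neg_scale (n := n) (p := p) hd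
    rw [show (n : ℝ) - p = -s by rw [hp]; ring, ← hJdef] at hsc
    rw [← lintegral_indicator Metric.isOpen_ball.measurableSet.compl]
    calc _ ≤ ∫⁻ y, ENNReal.ofReal C * {z : Fin n → ℝ | 1 - ‖x‖ ≤ ‖z‖}.indicator
            (fun z => ENNReal.ofReal (‖z‖ ^ (-p))) (x - y) := by
          refine lintegral_mono fun y => ?_
          refine indicator_apply_le' (fun hy => ?_) (fun _ => zero_le)
          have hy1 : 1 ≤ ‖y‖ := by simpa using hy
          have : 1 - ‖x‖ ≤ ‖x - y‖ := by
            have := norm_sub_norm_le y x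
            rw [norm_sub_rev] at this
            linarith
          rw [indicator_of_mem (by exact this)]
          exact hle _
      _ = ENNReal.ofReal C * (ENNReal.ofReal ((1 - ‖x‖) ^ (-s)) * J) := by
          rw [lintegral_const_mul' _ _ ENNReal.ofReal_ne_top, ← hsc]
          congr 1
          exact lintegral_sub_left_eq_self _ x
      _ = _ := by ring
  calc fracPerimeter s K (Metric.ball 0 1) ≤ ∫⁻ x in Metric.ball (0 : Fin n → ℝ) 1,
        ENNReal.ofReal C * J * ENNReal.ofReal ((1 - ‖x‖) ^ (-s)) :=
        setLIntegral_mono' Metric.isOpen_ball.measurableSet hinner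
    _ < ∞ := by
        have hCJ : ENNReal.ofReal C * J < ∞ := ENNReal.mul_lt_top ENNReal.ofReal_lt_top hJ
        rw [lintegral_const_mul' _ _ hCJ.ne]
        exact ENNReal.mul_lt_top hCJ (lintegral_ball_one_sub_norm_rpow_lt_top hn hs1)

end Finiteness

/-! ### Minimizers and the reflection dichotomy. -/

lemma isoConst_mul_le {s : ℝ} {K E : Set (Fin n → ℝ)} (hE : Bornology.IsBounded E)
    (hEm : MeasurableSet E) :
    isoConst s K * volume E ^ (((n : ℝ) - s) / n) ≤ fracPerimeter s K E := by
  rw [isoConst, ENNReal.sSup_mul]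
  exact iSup₂_le fun c hc => hc E hE hEm

section Minimizer

variable {s : ℝ} {K M : Set (Fin n → ℝ)}

/-- Testing the inequality with the unit ball shows that the optimal constant is finite. -/
lemma IsIsoMinimizer.fracPerimeter_ne_top (hn : 1 ≤ n) (hs0 : 0 < s) (hs1 : s < 1)
    (hK : IsConvexBody K) (hKunc : IsUnconditional K) (hM : IsIsoMinimizer s K M) :
    fracPerimeter s K M ≠ ∞ := by
  have hn' : (1 : ℝ) ≤ n := by exact_mod_cast hn
  have hq : 0 ≤ ((n : ℝ) - s) / n := div_nonneg (by linarith) (by linarith)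
  have hball := isoConst_mul_le (s := s) (K := K) (Metric.isBounded_ball (x := (0 : Fin n → ℝ)) (r := 1))
    Metric.isOpen_ball.measurableSet
  have hfin := (hball.trans_lt (fracPerimeter_ball_lt_top hn hK hKunc hs0 hs1))
  have hvol : volume (Metric.ball (0 : Fin n → ℝ) 1) ^ (((n : ℝ) - s) / n) ≠ 0 :=
    (ENNReal.rpow_pos (Metric.measure_ball_pos volume _ one_pos)
      Metric.isBounded_ball.measure_lt_top.ne).ne'
  have hconst : isoConst s K ≠ ∞ := by
    intro h
    rw [h, ENNReal.top_mul hvol] at hfin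
    exact lt_irrefl _ hfin
  rw [hM.eq]
  exact ENNReal.mul_ne_top hconst
    (ENNReal.rpow_ne_top_of_nonneg hq hM.isBounded.measure_lt_top.ne)

/-- The polarization of `M` is a competitor of the same volume, so its perimeter cannot be smaller.
-/
lemma IsIsoMinimizer.reflect_dichotomy (hn : 1 ≤ n) (hs0 : 0 < s) (hs1 : s < 1)
    (hK : IsConvexBody K) (hKs : StrictConvex ℝ K) (hKunc : IsUnconditional K)
    (hM : IsIsoMinimizer s K M) (i : Fin n) (c : ℝ) :
    (∀ᵐ x : Fin n → ℝ, c < x i → x ∈ M → hypReflect i c x ∈ M) ∨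
      (∀ᵐ x : Fin n → ℝ, c < x i → hypReflect i c x ∈ M → x ∈ M) := by
  have hge : fracPerimeter s K M ≤ fracPerimeter s K (polarize i c M) := by
    rw [hM.eq, ← volume_polarize (i := i) (c := c) hM.measurableSet]
    exact isoConst_mul_le (isBounded_polarize hM.isBounded) (measurableSet_polarize hM.measurableSet)
  refine (null_or_null_of_fracPerimeter_polarize_ge hK hKs hKunc hs0 hM.measurableSet i c
    (hM.fracPerimeter_ne_top hn hs0 hs1 hK hKunc) hge).imp (fun h => ?_) (fun h => ?_)
  · filter_upwards [measure_eq_zero_iff_ae_notMem.1 h] with x hx h1 h2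
    by_contra h3
    exact hx ⟨h1, h2, h3⟩
  · filter_upwards [measure_eq_zero_iff_ae_notMem.1 h] with x hx h1 h2
    by_contra h3
    exact hx ⟨h1, h2, h3⟩

end Minimizer

/-! ### First moments select the alternative. -/

section Moment

variable {M : Set (Fin n → ℝ)} {i : Fin n} {c : ℝ}

lemma ae_of_ae_halfSpace {P : (Fin n → ℝ) → Prop}
    (h : ∀ᵐ x : Fin n → ℝ, c < x i → P x ∧ P (hypReflect i c x)) : ∀ᵐ x, P x := by
  filter_upwards [h, (measurePreserving_hypReflect i c).quasiMeasurePreserving.ae h,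
    ae_ne_hyperplane i c] with x h1 h2 h3
  rcases lt_or_gt_of_ne h3 with h4 | h4
  · simpa using (h2 (by rw [hypReflect_self]; linarith)).2
  · exact (h1 h4).1

lemma integrableOn_coord_sub (hMb : Bornology.IsBounded M) (hMm : MeasurableSet M)
    (i : Fin n) (c : ℝ) : IntegrableOn (fun x : Fin n → ℝ => x i - c) M := by
  obtain ⟨R, hR⟩ := hMb.subset_closedBall (0 : Fin n → ℝ)
  have hcont : Continuous fun x : Fin n → ℝ => x i - c := by fun_prop
  refine Measure.integrableOn_of_bounded (M := R + |c|) hMb.measure_lt_top.ne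
    hcont.aestronglyMeasurable ?_
  filter_upwards [ae_restrict_mem hMm] with x hx
  have h1 : ‖x‖ ≤ R := by simpa using hR hx
  have h2 := norm_le_pi_norm x i
  have h3 := norm_sub_le (x i) c
  rw [Real.norm_eq_abs c] at h3
  linarith

open Classical in
/-- `(x i - c) (1_M(x) - 1_M(σ x))`, where `σ` is the reflection in `{x | x i = c}`. -/
noncomputable def foldedMoment (M : Set (Fin n → ℝ)) (i : Fin n) (c : ℝ) (x : Fin n → ℝ) : ℝ :=
  (x i - c) * ((if x ∈ M then 1 else 0) - (if hypReflect i c x ∈ M then 1 else 0))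

lemma foldedMoment_eq (x : Fin n → ℝ) : foldedMoment M i c x =
    M.indicator (fun x => x i - c) x + M.indicator (fun x => x i - c) (hypReflect i c x) := by
  classical
  simp only [foldedMoment, indicator_apply, hypReflect_self]
  split_ifs <;> ring

/-- Either alternative of the dichotomy gives the folded integrand a constant sign, so the sign of
the moment can exclude an alternative. -/
lemma setIntegral_coord_sub_eq (hMb : Bornology.IsBounded M) (hMm : MeasurableSet M) :
    ∫ x in M, (x i - c) = ∫ x in halfSpace i c, foldedMoment M i c x := by
  have hint := (integrable_indicator_iff hMm).2 (integrableOn_coord_sub hMb hMm i c)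
  rw [← integral_indicator hMm, integral_eq_fold i c hint]
  simp only [foldedMoment_eq]

lemma integrableOn_foldedMoment (hMb : Bornology.IsBounded M) (hMm : MeasurableSet M) :
    IntegrableOn (foldedMoment M i c) (halfSpace i c) := by
  have hint := (integrable_indicator_iff hMm).2 (integrableOn_coord_sub hMb hMm i c)
  have h := hint.add ((measurePreserving_hypReflect i c).integrable_comp_of_integrable hint)
  refine (h.congr (Eventually.of_forall fun x => ?_)).integrableOn
  exact (foldedMoment_eq x).symm

lemma foldedMoment_nonpos_of_ae (h : ∀ᵐ x : Fin n → ℝ, c < x i → x ∈ M → hypReflect i c x ∈ M) :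
    foldedMoment M i c ≤ᵐ[volume.restrict (halfSpace i c)] 0 := by
  rw [EventuallyLE, ae_restrict_iff' (measurableSet_halfSpace i c)]
  filter_upwards [h] with x hx h1
  have h2 := hx h1
  have h1' : c < x i := h1
  simp only [foldedMoment, Pi.zero_apply]
  refine mul_nonpos_of_nonneg_of_nonpos (by linarith) ?_
  by_cases h3 : x ∈ M
  · simp [h3, h2 h3]
  · simp only [h3, if_false]; split_ifs <;> norm_num

lemma foldedMoment_nonneg_of_ae (h : ∀ᵐ x : Fin n → ℝ, c < x i → hypReflect i c x ∈ M → x ∈ M) :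
    0 ≤ᵐ[volume.restrict (halfSpace i c)] foldedMoment M i c := by
  rw [EventuallyLE, ae_restrict_iff' (measurableSet_halfSpace i c)]
  filter_upwards [h] with x hx h1
  have h2 := hx h1
  have h1' : c < x i := h1
  simp only [foldedMoment, Pi.zero_apply]
  refine mul_nonneg (by linarith) ?_
  by_cases h3 : hypReflect i c x ∈ M
  · simp [h3, h2 h3]
  · simp only [h3, if_false]; split_ifs <;> norm_num

lemma ae_symm_of_foldedMoment_eq_zero
    (h : foldedMoment M i c =ᵐ[volume.restrict (halfSpace i c)] 0) :
    ∀ᵐ x : Fin n → ℝ, x ∈ M ↔ hypReflect i c x ∈ M := by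
  rw [EventuallyEq, ae_restrict_iff' (measurableSet_halfSpace i c)] at h
  refine ae_of_ae_halfSpace (i := i) (c := c) ?_
  filter_upwards [h] with x hx h1
  have h2 := hx h1
  have h3 : x i - c ≠ 0 := (sub_pos.2 h1).ne'
  simp only [foldedMoment, Pi.zero_apply, mul_eq_zero, h3, false_or] at h2
  rw [hypReflect_hypReflect]
  by_cases h4 : x ∈ M <;> by_cases h5 : hypReflect i c x ∈ M <;> simp_all

/-- The barycenter of `M`. -/
noncomputable def barycenter (M : Set (Fin n → ℝ)) (i : Fin n) : ℝ :=
  (∫ x in M, x i) / volume.real M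

lemma setIntegral_coord_sub (hMb : Bornology.IsBounded M) (hMm : MeasurableSet M)
    (hpos : 0 < volume M) (i : Fin n) (c : ℝ) :
    ∫ x in M, (x i - c) = (barycenter M i - c) * volume.real M := by
  have hv : 0 < volume.real M := ENNReal.toReal_pos hpos.ne' hMb.measure_lt_top.ne
  have h0 : IntegrableOn (fun x : Fin n → ℝ => x i) M := by
    simpa using integrableOn_coord_sub hMb hMm i 0
  rw [integral_sub h0 (integrableOn_const hMb.measure_lt_top.ne), setIntegral_const, barycenter,
    smul_eq_mul]
  field_simp

/-- For every hyperplane orthogonal to a coordinate axis, one of the two halves of `M` reflects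
into the other one, up to null sets. -/
def ReflectDichotomy (M : Set (Fin n → ℝ)) : Prop :=
  ∀ (i : Fin n) (c : ℝ), (∀ᵐ x : Fin n → ℝ, c < x i → x ∈ M → hypReflect i c x ∈ M) ∨
      (∀ᵐ x : Fin n → ℝ, c < x i → hypReflect i c x ∈ M → x ∈ M)

variable (hMb : Bornology.IsBounded M) (hMm : MeasurableSet M) (hpos : 0 < volume M)
  (hD : ReflectDichotomy M)

include hMb hMm hpos hD

/-- The moment about the barycenter is zero, while its folded integrand has constant sign; hence the
integrand vanishes almost everywhere. -/
lemma ReflectDichotomy.ae_symm (i : Fin n) :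
    ∀ᵐ x : Fin n → ℝ, x ∈ M ↔ hypReflect i (barycenter M i) x ∈ M := by
  have hz : ∫ x in halfSpace i (barycenter M i), foldedMoment M i (barycenter M i) x = 0 := by
    rw [← setIntegral_coord_sub_eq hMb hMm, setIntegral_coord_sub hMb hMm hpos, sub_self, zero_mul]
  have hint := integrableOn_foldedMoment (i := i) (c := barycenter M i) hMb hMm
  refine ae_symm_of_foldedMoment_eq_zero ?_
  rcases hD i (barycenter M i) with h | h
  · have h1 := foldedMoment_nonpos_of_ae h
    have h2 : 0 ≤ᵐ[volume.restrict (halfSpace i (barycenter M i))]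
        fun x => -foldedMoment M i (barycenter M i) x := by
      filter_upwards [h1] with x hx
      simpa using hx
    have h3 := (integral_eq_zero_iff_of_nonneg_ae h2 hint.neg).1 (by rw [integral_neg, hz, neg_zero])
    filter_upwards [h3] with x hx
    simpa using hx
  · exact (integral_eq_zero_iff_of_nonneg_ae (foldedMoment_nonneg_of_ae h) hint).1 hz

/-- The other alternative would make the moment about `c` nonnegative, yet it equals `(barycenter M
i - c)` times the volume. -/
lemma ReflectDichotomy.ae_of_barycenter_lt (i : Fin n) {c : ℝ} (hc : barycenter M i < c) :
    ∀ᵐ x : Fin n → ℝ, c < x i → x ∈ M → hypReflect i c x ∈ M := by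
  refine (hD i c).resolve_right fun h => ?_
  have h1 := integral_nonneg_of_ae (foldedMoment_nonneg_of_ae h)
  rw [← setIntegral_coord_sub_eq hMb hMm, setIntegral_coord_sub hMb hMm hpos] at h1
  have hv : 0 < volume.real M := ENNReal.toReal_pos hpos.ne' hMb.measure_lt_top.ne
  exact absurd h1 (not_le.2 (mul_neg_of_neg_of_pos (by linarith) hv))

lemma ReflectDichotomy.ae_of_lt_barycenter (i : Fin n) {c : ℝ} (hc : c < barycenter M i) :
    ∀ᵐ x : Fin n → ℝ, x i < c → x ∈ M → hypReflect i c x ∈ M := by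
  have h : ∀ᵐ x : Fin n → ℝ, c < x i → hypReflect i c x ∈ M → x ∈ M := by
    refine (hD i c).resolve_left fun h => ?_
    have h1 := integral_nonpos_of_ae (foldedMoment_nonpos_of_ae h)
    rw [← setIntegral_coord_sub_eq hMb hMm, setIntegral_coord_sub hMb hMm hpos] at h1
    have hv : 0 < volume.real M := ENNReal.toReal_pos hpos.ne' hMb.measure_lt_top.ne
    exact absurd h1 (not_le.2 (mul_pos (by linarith) hv))
  filter_upwards [(measurePreserving_hypReflect i c).quasiMeasurePreserving.ae h] with x hx h1 h2
  rw [hypReflect_hypReflect, hypReflect_self] at hx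
  exact hx (by linarith) h2

/-- Reflecting at `b + h / 2` and then at the barycenter `b` is translation by `-h` along axis `i`.
The assumption on `x` says that it lies beyond `b + h / 2` as seen from `b`, where the first
reflection keeps points in `M`. -/
lemma ReflectDichotomy.ae_shift (i : Fin n) (h : ℝ) :
    ∀ᵐ x : Fin n → ℝ, |x i - barycenter M i - h| < |x i - barycenter M i| → x ∈ M →
      x - Pi.single i h ∈ M := by
  set b := barycenter M i with hb
  have hcomp : ∀ x : Fin n → ℝ,
      hypReflect i b (hypReflect i (b + h / 2) x) = x - Pi.single i h := by
    intro x
    ext j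
    by_cases hj : j = i
    · subst hj
      simp only [hypReflect_self, Pi.sub_apply, Pi.single_eq_same]
      ring
    · simp [hypReflect_of_ne hj, hj]
  have hs := (measurePreserving_hypReflect i (b + h / 2)).quasiMeasurePreserving.ae
    (hD.ae_symm hMb hMm hpos i)
  simp only [← hb, hcomp] at hs
  rcases lt_trichotomy h 0 with hh | rfl | hh
  · filter_upwards [hs, hD.ae_of_lt_barycenter hMb hMm hpos i (c := b + h / 2) (by linarith)]
      with x h1 h2 h3 h4
    refine h1.1 (h2 ?_ h4)
    rw [← sq_lt_sq] at h3
    nlinarith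
  · filter_upwards with x h1
    simp at h1
  · filter_upwards [hs, hD.ae_of_barycenter_lt hMb hMm hpos i (c := b + h / 2) (by linarith)]
      with x h1 h2 h3 h4
    refine h1.1 (h2 ?_ h4)
    rw [← sq_lt_sq] at h3
    nlinarith

end Moment

/-! ### Solid sets and their radial functions. -/

section OrderConvex

/-- A set is solid if it contains with `x` every `y` with `|y j| ≤ |x j|` for all `j`. -/
def IsSolid (L : Set (Fin n → ℝ)) : Prop :=
  ∀ ⦃x y : Fin n → ℝ⦄, x ∈ L → (∀ j, |y j| ≤ |x j|) → y ∈ L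

variable {L : Set (Fin n → ℝ)}

lemma IsSolid.isUnconditional (hL : IsSolid L) : IsUnconditional L := by
  have habs : ∀ (i : Fin n) (x : Fin n → ℝ) (j : Fin n), |coordReflection i x j| = |x j| := by
    intro i x j
    by_cases hj : j = i
    · subst hj; simp [coordReflection]
    · simp [coordReflection, hj]
  intro i
  ext x
  constructor
  · rintro ⟨y, hy, rfl⟩
    exact hL hy fun j => (habs i y j).le
  · intro hx
    exact ⟨coordReflection i x, hL hx fun j => (habs i x j).le, by simp [coordReflection]⟩

lemma bddAbove_radial (hb : Bornology.IsBounded L) {x : Fin n → ℝ} (hx : x ≠ 0) :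
    BddAbove {t : ℝ | 0 ≤ t ∧ t • x ∈ L} := by
  obtain ⟨R, hR⟩ := hb.subset_closedBall (0 : Fin n → ℝ)
  refine ⟨R / ‖x‖, ?_⟩
  rintro t ⟨ht, htx⟩
  have h := mem_closedBall_zero_iff.1 (hR htx)
  rw [norm_smul, Real.norm_of_nonneg ht] at h
  rwa [le_div_iff₀ (norm_pos_iff.2 hx)]

/-- Openness gives lower semicontinuity, and solidity gives upper semicontinuity. -/
lemma IsSolid.continuousOn_radialFun (hL : IsSolid L) (hb : Bornology.IsBounded L)
    (ho : IsOpen L) (h0 : (0 : Fin n → ℝ) ∈ L) : ContinuousOn (radialFun L) {x | x ≠ 0} := by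
  intro x hx
  have hx : x ≠ 0 := hx
  have hne : ∀ y : Fin n → ℝ, {t : ℝ | 0 ≤ t ∧ t • y ∈ L}.Nonempty := fun y =>
    ⟨0, le_rfl, by simpa using h0⟩
  have hev : ∀ᶠ y in 𝓝[{x | x ≠ 0}] x, y ≠ 0 := self_mem_nhdsWithin
  refine tendsto_order.2 ⟨fun a ha => ?_, fun a ha => ?_⟩
  · obtain ⟨t, ⟨ht0, htx⟩, hat⟩ := exists_lt_of_lt_csSup (hne x) ha
    have hopen : IsOpen {y : Fin n → ℝ | t • y ∈ L} := ho.preimage (continuous_const_smul t)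
    filter_upwards [hev, mem_nhdsWithin_of_mem_nhds (hopen.mem_nhds htx)] with y hy hty
    exact hat.trans_le (le_csSup (bddAbove_radial hb hy) ⟨ht0, hty⟩)
  · have hρ : 0 ≤ radialFun L x :=
      le_csSup (bddAbove_radial hb hx) ⟨le_rfl, by simpa using h0⟩
    -- The gap between `a₁` and `a₂` leaves room for perturbation: for `y` near `x`, `a₂ • y`
    -- dominates `a₁ • x` in every coordinate, so `t • y ∈ L` with `t > a₂` would force `a₁ • x ∈
    -- L`.
    obtain ⟨a₂, h2, h2a⟩ := exists_between ha
    obtain ⟨a₁, h1, h12⟩ := exists_between h2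
    have hnot : a₁ • x ∉ L := fun h =>
      absurd (le_csSup (bddAbove_radial hb hx) ⟨hρ.trans h1.le, h⟩) (not_le.2 h1)
    have hnear : ∀ᶠ y in 𝓝 x, ∀ j, |a₁ * x j| ≤ |a₂ * y j| := by
      refine eventually_all.2 fun j => ?_
      by_cases hj : x j = 0
      · exact Eventually.of_forall fun y => by simpa [hj] using abs_nonneg (a₂ * y j)
      · have hlt : |a₁ * x j| < |a₂ * x j| := by
          rw [abs_mul, abs_mul, abs_of_nonneg (hρ.trans h1.le), abs_of_nonneg (hρ.trans h2.le)]
          exact mul_lt_mul_of_pos_right h12 (abs_pos.2 hj)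
        have hc : Continuous fun y : Fin n → ℝ => |a₂ * y j| := by fun_prop
        exact (hc.continuousAt.eventually_const_lt hlt).mono fun y hy => hy.le
    filter_upwards [mem_nhdsWithin_of_mem_nhds hnear] with y hy
    refine (csSup_le (hne y) ?_).trans_lt h2a
    rintro t ⟨ht0, hty⟩
    by_contra! hlt
    refine hnot (hL hty fun j => ?_)
    refine (hy j).trans ?_
    simp only [Pi.smul_apply, smul_eq_mul, abs_mul]
    rw [abs_of_nonneg (hρ.trans h2.le), abs_of_nonneg ht0]
    exact mul_le_mul_of_nonneg_right hlt.le (abs_nonneg _)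

lemma IsSolid.isStarBody (hL : IsSolid L) (hb : Bornology.IsBounded L)
    (ho : IsOpen L) (hne : L.Nonempty) : IsStarBody L := by
  obtain ⟨x, hx⟩ := hne
  have h0 : (0 : Fin n → ℝ) ∈ L := hL hx fun j => by simp
  refine ⟨hb, ?_, ?_, hL.continuousOn_radialFun hb ho h0⟩
  · refine starConvex_zero_iff.2 fun x hx a ha0 ha1 => hL hx fun j => ?_
    rw [Pi.smul_apply, smul_eq_mul, abs_mul, abs_of_nonneg ha0]
    exact mul_le_of_le_one_left (abs_nonneg _) ha1
  · rwa [ho.interior_eq]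

end OrderConvex

/-! ### The open solid representative. -/

section Representative

/-- The open box with vertices `(± x 1, …, ± x n)`. -/
def openBox (x : Fin n → ℝ) : Set (Fin n → ℝ) := {y | ∀ j, |y j| < |x j|}

lemma isOpen_openBox (x : Fin n → ℝ) : IsOpen (openBox x) := by
  have : openBox x = ⋂ j, {y : Fin n → ℝ | |y j| < |x j|} := by
    ext y; simp [openBox]
  rw [this]
  exact isOpen_iInter_of_finite fun j => isOpen_lt (by fun_prop) continuous_const

variable {N : Set (Fin n → ℝ)}

/-- Moving a point of `N` towards a coordinate hyperplane does not leave `N`, up to null sets. -/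
def ShiftInvariant (N : Set (Fin n → ℝ)) : Prop :=
  ∀ (i : Fin n) (h : ℝ), ∀ᵐ x : Fin n → ℝ, |x i - h| < |x i| → x ∈ N → x - Pi.single i h ∈ N

lemma ShiftInvariant.ae_sub_mem (hN : ShiftInvariant N) (h : Fin n → ℝ) :
    ∀ᵐ x : Fin n → ℝ, x - h ∈ openBox x → x ∈ N → x - h ∈ N := by
  have key : ∀ S : Finset (Fin n), ∀ᵐ x : Fin n → ℝ, (∀ j ∈ S, |x j - h j| < |x j|) → x ∈ N →
      x - ∑ j ∈ S, Pi.single j (h j) ∈ N := by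
    intro S
    induction S using Finset.induction_on with
    | empty => exact Eventually.of_forall fun x _ hx => by simpa using hx
    | insert i S hi ih =>
      have h1 := (measurePreserving_sub_right (volume : Measure (Fin n → ℝ))
        (∑ j ∈ S, Pi.single j (h j))).quasiMeasurePreserving.ae (hN i (h i))
      filter_upwards [ih, h1] with x hx1 hx2 hx3 hx4
      have h2 := hx1 (fun j hj => hx3 j (Finset.mem_insert_of_mem hj)) hx4
      -- The earlier moves leave coordinate `i` untouched, so the assumption on `x i` still applies.
      have h3 : (x - ∑ j ∈ S, Pi.single j (h j)) i = x i := by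
        have : ∀ j ∈ S, (Pi.single j (h j) : Fin n → ℝ) i = 0 := fun j hj =>
          Pi.single_eq_of_ne (by rintro rfl; exact hi hj) _
        rw [Pi.sub_apply, Finset.sum_apply, Finset.sum_eq_zero this, sub_zero]
      rw [h3] at hx2
      have h4 := hx2 (hx3 i (Finset.mem_insert_self _ _)) h2
      rwa [Finset.sum_insert hi, add_comm, ← sub_sub]
  filter_upwards [key Finset.univ] with x hx h1 h2
  rw [Finset.univ_sum_single] at hx
  exact hx (fun j _ => h1 j) h2

/-- The exceptional null set of `ae_sub_mem` depends on `h`. Fubini exchanges "every `h`, almost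
every `x`" for "almost every `x`, almost every `h`", and then `y = x - h` is substituted. -/
lemma ShiftInvariant.ae_openBox_subset (hN : ShiftInvariant N) (hNm : MeasurableSet N) :
    ∀ᵐ x : Fin n → ℝ, x ∈ N → ∀ᵐ y : Fin n → ℝ, y ∈ openBox x → y ∈ N := by
  have hmeas : MeasurableSet {p : (Fin n → ℝ) × (Fin n → ℝ) |
      p.2 - p.1 ∈ openBox p.2 → p.2 ∈ N → p.2 - p.1 ∈ N} := by
    have h1 : MeasurableSet {p : (Fin n → ℝ) × (Fin n → ℝ) | p.2 - p.1 ∈ openBox p.2} := by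
      have : {p : (Fin n → ℝ) × (Fin n → ℝ) | p.2 - p.1 ∈ openBox p.2} =
          ⋂ j, {p : (Fin n → ℝ) × (Fin n → ℝ) | |(p.2 - p.1) j| < |p.2 j|} := by
        ext p; simp [openBox]
      rw [this]
      refine (isOpen_iInter_of_finite fun j => isOpen_lt ?_ ?_).measurableSet
      · simp only [Pi.sub_apply]; fun_prop
      · fun_prop
    have h2 : MeasurableSet {p : (Fin n → ℝ) × (Fin n → ℝ) | p.2 ∈ N} := measurable_snd hNm
    have h3 : MeasurableSet {p : (Fin n → ℝ) × (Fin n → ℝ) | p.2 - p.1 ∈ N} :=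
      (measurable_snd.sub measurable_fst) hNm
    exact h1.imp (h2.imp h3)
  have h := (Measure.ae_ae_comm (μ := (volume : Measure (Fin n → ℝ)))
    (ν := (volume : Measure (Fin n → ℝ))) hmeas).1
    (Eventually.of_forall hN.ae_sub_mem)
  filter_upwards [h] with x hx hxN
  filter_upwards [(Measure.measurePreserving_sub_left (volume : Measure (Fin n → ℝ))
    x).quasiMeasurePreserving.ae hx] with y hy hyb
  rw [sub_sub_cancel] at hy
  exact hy hyb hxN

/-- The union of all open boxes `openBox x` that are contained in `N` up to a null set. -/
def boxHull (N : Set (Fin n → ℝ)) : Set (Fin n → ℝ) :=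
  {z | ∃ x : Fin n → ℝ, (∀ᵐ y : Fin n → ℝ, y ∈ openBox x → y ∈ N) ∧ z ∈ openBox x}

lemma isSolid_boxHull : IsSolid (boxHull N) := by
  rintro z w ⟨x, hx, hz⟩ hw
  exact ⟨x, hx, fun j => (hw j).trans_lt (hz j)⟩

lemma isOpen_boxHull : IsOpen (boxHull N) := by
  refine isOpen_iff_mem_nhds.2 ?_
  rintro z ⟨x, hx, hz⟩
  exact mem_of_superset ((isOpen_openBox x).mem_nhds hz) fun w hw => ⟨x, hx, hw⟩

lemma isBounded_boxHull (hNb : Bornology.IsBounded N) : Bornology.IsBounded (boxHull N) := by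
  obtain ⟨R, hR⟩ := hNb.subset_closedBall (0 : Fin n → ℝ)
  refine Metric.isBounded_closedBall.subset (s := boxHull N) (t := Metric.closedBall 0 R) ?_
  rintro z ⟨x, hx, hz⟩
  by_contra hzR
  -- The part of the box outside the ball is open and null, hence empty.
  have hopen : IsOpen (openBox x ∩ (Metric.closedBall (0 : Fin n → ℝ) R)ᶜ) :=
    (isOpen_openBox x).inter Metric.isClosed_closedBall.isOpen_compl
  have hnull : volume (openBox x ∩ (Metric.closedBall (0 : Fin n → ℝ) R)ᶜ) = 0 := by
    refine measure_eq_zero_iff_ae_notMem.2 ?_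
    filter_upwards [hx] with y hy h
    exact h.2 (hR (hy h.1))
  exact (hopen.measure_pos volume ⟨z, hz, hzR⟩).ne' hnull

lemma boxHull_ae_le : boxHull N ≤ᵐ[volume] N := by
  rw [ae_le_set]
  -- The union of boxes is uncountable, so nullity is checked locally, one box around each point.
  refine measure_null_of_locally_null _ ?_
  rintro z ⟨⟨x, hx, hz⟩, -⟩
  refine ⟨openBox x ∩ (boxHull N \ N),
    inter_mem (mem_nhdsWithin_of_mem_nhds ((isOpen_openBox x).mem_nhds hz)) self_mem_nhdsWithin, ?_⟩
  refine measure_eq_zero_iff_ae_notMem.2 ?_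
  filter_upwards [hx] with y hy h
  exact h.2.2 (hy h.1)

/-- A point `x` is not in its own open box, but `r • x` is for `0 < r < 1` when no coordinate
vanishes. So the hull contains `r • A` for a subset `A` of full measure in `N`, and `r → 1` gives
the bound. -/
lemma ShiftInvariant.volume_le_volume_boxHull (hN : ShiftInvariant N) (hNm : MeasurableSet N) :
    volume N ≤ volume (boxHull N) := by
  set A : Set (Fin n → ℝ) :=
    {x | x ∈ N ∧ (∀ᵐ y : Fin n → ℝ, y ∈ openBox x → y ∈ N) ∧ ∀ j, x j ≠ 0} with hA
  have hNA : volume N ≤ volume A := by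
    refine measure_mono_ae ?_
    filter_upwards [hN.ae_openBox_subset hNm, ae_all_iff.2 fun j => ae_ne_hyperplane j (0 : ℝ)]
      with x h1 h2 h3
    exact ⟨h3, h1 h3, h2⟩
  have hle : ∀ r ∈ Ioo (0 : ℝ) 1, ENNReal.ofReal (r ^ n) * volume N ≤ volume (boxHull N) := by
    rintro r ⟨hr0, hr1⟩
    calc ENNReal.ofReal (r ^ n) * volume N ≤ ENNReal.ofReal (r ^ n) * volume A := by gcongr
      _ = volume ((fun x => r • x) '' A) := by
          have := Measure.addHaar_smul (volume : Measure (Fin n → ℝ)) r A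
          rw [← image_smul] at this
          rw [this]
          simp [abs_of_pos (pow_pos hr0 n)]
      _ ≤ volume (boxHull N) := by
          refine measure_mono ?_
          rintro _ ⟨x, ⟨-, hx, hx0⟩, rfl⟩
          refine ⟨x, hx, fun j => ?_⟩
          simp only [Pi.smul_apply, smul_eq_mul, abs_mul, abs_of_pos hr0]
          exact mul_lt_of_lt_one_left (abs_pos.2 (hx0 j)) hr1
  have hlim : Tendsto (fun r : ℝ => ENNReal.ofReal (r ^ n) * volume N) (𝓝[<] 1)
      (𝓝 (ENNReal.ofReal (1 ^ n) * volume N)) := by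
    refine ENNReal.Tendsto.mul_const ?_ (Or.inl (by simp))
    have hc : Continuous fun r : ℝ => ENNReal.ofReal (r ^ n) :=
      ENNReal.continuous_ofReal.comp (continuous_pow n)
    exact hc.continuousAt.continuousWithinAt
  have h1 := le_of_tendsto hlim (b := volume (boxHull N)) (by
    filter_upwards [Ioo_mem_nhdsLT (show (0 : ℝ) < 1 by norm_num)] with r hr using hle r hr)
  simpa using h1

lemma ShiftInvariant.boxHull_ae_eq (hN : ShiftInvariant N) (hNm : MeasurableSet N)
    (hNb : Bornology.IsBounded N) : boxHull N =ᵐ[volume] N :=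
  ae_eq_of_ae_subset_of_measure_ge boxHull_ae_le (hN.volume_le_volume_boxHull hNm)
    isOpen_boxHull.measurableSet.nullMeasurableSet hNb.measure_lt_top.ne

end Representative

lemma ReflectDichotomy.exists_starBody {M : Set (Fin n → ℝ)} (hD : ReflectDichotomy M)
    (hMb : Bornology.IsBounded M) (hMm : MeasurableSet M) (hpos : 0 < volume M) :
    ∃ (v : Fin n → ℝ) (L : Set (Fin n → ℝ)),
      IsStarBody L ∧ IsUnconditional L ∧ volume (symmDiff M ((fun x => v + x) '' L)) = 0 := by
  set b := barycenter M with hb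
  -- Centring at the barycenter turns `ae_shift` into `ShiftInvariant`.
  set N : Set (Fin n → ℝ) := (fun x => b + x) ⁻¹' M with hNdef
  have hpres := measurePreserving_add_left (volume : Measure (Fin n → ℝ)) b
  have hNm : MeasurableSet N := hpres.measurable hMm
  have hNb : Bornology.IsBounded N := (isometry_add_left b).antilipschitz.isBounded_preimage hMb
  have hN : ShiftInvariant N := by
    intro i h
    filter_upwards [hpres.quasiMeasurePreserving.ae (hD.ae_shift hMb hMm hpos i h)] with x hx h1 h2
    have h3 := hx (by simpa [hb] using h1) h2
    rwa [add_sub_assoc] at h3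
  have hae := hN.boxHull_ae_eq hNm hNb
  have hNpos : 0 < volume N := by
    rw [hNdef, hpres.measure_preimage hMm.nullMeasurableSet]
    exact hpos
  have hne : (boxHull N).Nonempty :=
    nonempty_of_measure_ne_zero (measure_congr hae ▸ hNpos.ne')
  refine ⟨b, boxHull N, isSolid_boxHull.isStarBody (isBounded_boxHull hNb) isOpen_boxHull hne,
    isSolid_boxHull.isUnconditional, ?_⟩
  rw [measure_symmDiff_eq_zero_iff, image_add_left]
  have h1 := (measurePreserving_add_left (volume : Measure (Fin n → ℝ))
    (-b)).quasiMeasurePreserving.preimage_ae_eq hae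
  have h2 : (fun x => -b + x) ⁻¹' N = M := by
    ext x; simp [hNdef]
  rw [h2] at h1
  exact h1.symm

end AnisoFrac

theorem mainTheorem1 (n : ℕ) (hn : 1 ≤ n) (s : ℝ) (hs0 : 0 < s) (hs1 : s < 1)
    (K : Set (Fin n → ℝ)) (hK : AnisoFrac.IsConvexBody K) (hKstrict : StrictConvex ℝ K)
    (hKunc : AnisoFrac.IsUnconditional K)
    (M : Set (Fin n → ℝ)) (hM : AnisoFrac.IsIsoMinimizer s K M) :
    ∃ (v : Fin n → ℝ) (L : Set (Fin n → ℝ)),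
      AnisoFrac.IsStarBody L ∧ AnisoFrac.IsUnconditional L ∧
        volume (symmDiff M ((fun x => v + x) '' L)) = 0 := by
  have hD : AnisoFrac.ReflectDichotomy M := fun i c =>
    hM.reflect_dichotomy hn hs0 hs1 hK hKstrict hKunc i c
  exact hD.exists_starBody hM.isBounded hM.measurableSet hM.volume_pos
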